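/- Let $(X,d)$ be one of the spaces (a)–(c) below, equipped with its Borel $\sigma$-algebra, and let $\mathcal V$ be the set of all Borel probability measures on $X$. For $\nu_1,\nu_2\in\mathcal V$ let $$W(\nu_1,\nu_2)=\inf_{\gamma}\int_{X\times X} d(x_1,x_2)\,d\gamma(x_1,x_2),$$ the infimum being taken over all couplings $\gamma$ of $\nu_1$ and $\nu_2$. Let $m$ be the uniform probability measure on $X$, let $N\ge 1$, let $X_1,\dots,X_N$ be i.i.d. random variables (on any probability space) with values in $X$ and distribution $m$, and let $m_N=\frac1N\sum_{i=1}^N\delta_{X_i}$ be their empirical measure. (a) $X=\{-1,1\}^n$ with $n\ge 0$, $d(x,y)=\#\{i: x_i\ne y_i\}$ is the Hamming distance, and $m(\{x\})=2^{-n}$ for every $x$. (b) $X=\mathbb T^n=(\mathbb R/\mathbb Z)^n$ with $n\ge 0$, $d(x,y)=\|x-y\|_p$ for some $p\in[1,\infty]$, that is, the $\ell_p$ norm of the vector $\big(\min_{k\in\mathbb Z}|x_i-y_i+k|\big)_{i=1}^n$, and $m$ is the $n$-fold product of the Lebesgue measure on $\mathbb R/\mathbb Z$. (c) $X=S^{n-1}=\{x\in\mathbb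 R^n:\|x\|_2=1\}$ with $n\ge 1$, $d(x,y)=\arccos(\langle x,y\rangle)$ is the geodesic distance, and $m$ is the normalized surface measure. Then in each of the three cases, for every $N\ge 1$, $$m\in\operatorname*{arg\,min}_{\upsilon\in\mathcal V}\ \mathbb E\big[W(m_N,\upsilon)\big],$$ that is, $\mathbb E[W(m_N,m)]\le\mathbb E[W(m_N,\upsilon)]$ for every $\upsilon\in\mathcal V$. -/

import Mathlib

open MeasureTheory ProbabilityTheory
open scoped ENNReal

noncomputable section

namespace BestGuess

/-! ### Couplings, Wasserstein distance, empirical measures -/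

/-- The couplings of two measures: measures on the product with the given marginals. -/
def couplings {S : Type*} [MeasurableSpace S] (ν₁ ν₂ : Measure S) : Set (Measure (S × S)) :=
  {γ | γ.map Prod.fst = ν₁ ∧ γ.map Prod.snd = ν₂}

/-- The Wasserstein distance `W(ν₁, ν₂) = inf_γ ∫ d(x₁, x₂) dγ(x₁, x₂)` with respect to the
distance function `d`, the infimum being over all couplings. It takes values in `[0, ∞]`. -/
def wasserstein {S : Type*} [MeasurableSpace S] (d : S → S → ℝ) (ν₁ ν₂ : Measure S) : ℝ≥0∞ :=
  ⨅ γ ∈ couplings ν₁ ν₂, ∫⁻ z, ENNReal.ofReal (d z.1 z.2) ∂γ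

/-- The empirical measure `(1/N) ∑ᵢ δ_{xᵢ}` of the points `x₁, …, x_N`. -/
def empirical {S : Type*} [MeasurableSpace S] {N : ℕ} (x : Fin N → S) : Measure S :=
  (N : ℝ≥0∞)⁻¹ • ∑ i, Measure.dirac (x i)

/-- `X₁, …, X_N` are i.i.d. random variables on `(Ω, P)`, each with distribution `m`. -/
def IsSample {Ω S : Type*} [MeasurableSpace Ω] [MeasurableSpace S] {N : ℕ}
    (P : Measure Ω) (m : Measure S) (X : Fin N → Ω → S) : Prop :=
  iIndepFun X P ∧ ∀ i, HasLaw (X i) m P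

/-- `𝔼[W(m_N, υ)]`, where `m_N` is the empirical measure of the random points `X₁, …, X_N`. -/
def expectedWasserstein {Ω S : Type*} [MeasurableSpace Ω] [MeasurableSpace S] {N : ℕ}
    (P : Measure Ω) (d : S → S → ℝ) (X : Fin N → Ω → S) (υ : Measure S) : ℝ≥0∞ :=
  ∫⁻ ω, wasserstein d (empirical fun i => X i ω) υ ∂P

/-- `argmin_{υ} 𝔼[W(m_N, υ)]` over all probability measures `υ`. -/
def minimizers {Ω S : Type*} [MeasurableSpace Ω] [MeasurableSpace S] {N : ℕ}
    (P : Measure Ω) (d : S → S → ℝ) (X : Fin N → Ω → S) : Set (Measure S) :=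
  {υ | IsProbabilityMeasure υ ∧ ∀ υ' : Measure S, IsProbabilityMeasure υ' →
    expectedWasserstein P d X υ ≤ expectedWasserstein P d X υ'}

/-! ### The Boolean cube -/

/-- The Boolean cube `{-1, 1}ⁿ`; the units of `ℤ` are exactly `1` and `-1`. -/
abbrev Cube (n : ℕ) : Type := Fin n → ℤˣ

/-- The Hamming distance: the number of coordinates in which `x` and `y` differ. -/
def cubeDist (n : ℕ) (x y : Cube n) : ℝ := (hammingDist x y : ℝ)

/-- The uniform probability measure on the Boolean cube. -/
def cubeUniform (n : ℕ) : Measure (Cube n) := uniformOn Set.univ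

/-! ### The torus -/

/-- The torus `(ℝ/ℤ)ⁿ`. -/
abbrev Torus (n : ℕ) : Type := Fin n → UnitAddCircle

/-- The distance `‖x - y‖_p` on the torus: the `ℓ_p` norm (`p = ∞` included) of the vector of
circle distances `‖x i - y i‖ = min_{k ∈ ℤ} |x i - y i + k|`. -/
def torusDist (n : ℕ) (p : ℝ≥0∞) (x y : Torus n) : ℝ :=
  ‖(WithLp.toLp p (x - y) : PiLp p fun _ : Fin n => UnitAddCircle)‖

/-- The uniform probability measure on the torus: the product of the Lebesgue measures. -/
def torusUniform (n : ℕ) : Measure (Torus n) := volume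

/-! ### The sphere -/

/-- The unit sphere of `ℝⁿ`. -/
abbrev UnitSphere (n : ℕ) : Type := Metric.sphere (0 : EuclideanSpace ℝ (Fin n)) 1

/-- The geodesic distance `arccos ⟨x, y⟩` on the unit sphere. -/
def sphereDist (n : ℕ) (x y : UnitSphere n) : ℝ :=
  Real.arccos (inner ℝ (x : EuclideanSpace ℝ (Fin n)) (y : EuclideanSpace ℝ (Fin n)))

/-- The uniform probability measure on the unit sphere: the normalized surface measure. -/
def sphereUniform (n : ℕ) : Measure (UnitSphere n) :=
  ((volume : Measure (EuclideanSpace ℝ (Fin n))).toSphere Set.univ)⁻¹ •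
    (volume : Measure (EuclideanSpace ℝ (Fin n))).toSphere

end BestGuess

end

/-! Each space carries distance-preserving maps `a g`, with inverses `b g`, that preserve `m`, and a
probability law `μ` on the parameters under which `a g y` has law `m` for every `y`. Given `υ`,
transport the points `b g x` to `υ` and move everything by `a g`: this is a plan from `x` of the
same cost. Averaged over `g`, its target becomes `m`, so `W(x, m) ≤ ∫ W(b g x, υ) dμ`
(`wasserstein_empirical_le_lintegral`). Integrating over i.i.d. `x`, Tonelli and the invariance of
`m` turn the right side into `𝔼[W(m_N, υ)]` (`mem_minimizers_of_symmetric`). The averaging needs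
plans depending measurably on `g`, provided by `exists_measurable_plan_index`. The maps are
translations on the cube and torus, and Haar-random orthogonal maps on the sphere. -/

noncomputable section

namespace BestGuess

/-! ### Transport plans from empirical measures -/

variable {S : Type*} [MeasurableSpace S] {N : ℕ}

/-- The families `κ₁, …, κ_N` of probability measures with average `υ`. Such a family is a transport
plan from the empirical measure of any `N` points to `υ`: the `i`-th point is sent to `κᵢ`. -/
def plans (N : ℕ) (υ : Measure S) : Set (Fin N → Measure S) :=
  {κ | (∀ i, IsProbabilityMeasure (κ i)) ∧ (N : ℝ≥0∞)⁻¹ • ∑ i, κ i = υ}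

/-- The cost of transporting the empirical measure of `x` along the plan `κ`. -/
def planCost (d : S → S → ℝ) (κ : Fin N → Measure S) (x : Fin N → S) : ℝ≥0∞ :=
  (N : ℝ≥0∞)⁻¹ * ∑ i, ∫⁻ z, ENNReal.ofReal (d (x i) z) ∂κ i

theorem lintegral_average (ν : Fin N → Measure S) (f : S → ℝ≥0∞) :
    ∫⁻ z, f z ∂((N : ℝ≥0∞)⁻¹ • ∑ i, ν i) = (N : ℝ≥0∞)⁻¹ * ∑ i, ∫⁻ z, f z ∂ν i := by
  rw [lintegral_smul_measure, lintegral_finsetSum_measure, smul_eq_mul]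

theorem const_mem_plans (hN : N ≠ 0) (υ : Measure S) [IsProbabilityMeasure υ] :
    (fun _ => υ) ∈ plans N υ := by
  refine ⟨fun _ => inferInstance, ?_⟩
  ext s _
  simp [← mul_assoc, ENNReal.inv_mul_cancel (Nat.cast_ne_zero.2 hN) (ENNReal.natCast_ne_top N)]

theorem isProbabilityMeasure_empirical (hN : N ≠ 0) (x : Fin N → S) :
    IsProbabilityMeasure (empirical x) :=
  ⟨by simp [empirical,
    ENNReal.inv_mul_cancel (Nat.cast_ne_zero.2 hN) (ENNReal.natCast_ne_top N)]⟩

theorem wasserstein_empirical_le_planCost {d : S → S → ℝ} (hd : Measurable (Function.uncurry d))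
    {υ : Measure S} {κ : Fin N → Measure S} (hκ : κ ∈ plans N υ) (x : Fin N → S) :
    wasserstein d (empirical x) υ ≤ planCost d κ x := by
  have := hκ.1
  have hmem : (N : ℝ≥0∞)⁻¹ • ∑ i, (Measure.dirac (x i)).prod (κ i) ∈ couplings (empirical x) υ := by
    refine ⟨?_, ?_⟩
    · ext s hs
      rw [Measure.map_apply measurable_fst hs]
      simp [empirical, ← Set.prod_univ, Measure.prod_prod]
    · ext s hs
      rw [← hκ.2, Measure.map_apply measurable_snd hs]
      simp [← Set.univ_prod, Measure.prod_prod]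
  have hd' : Measurable fun z : S × S => ENNReal.ofReal (d z.1 z.2) := hd.ennreal_ofReal
  refine (iInf₂_le _ hmem).trans (le_of_eq ?_)
  rw [lintegral_average, planCost]
  congr 1
  refine Finset.sum_congr rfl fun i _ => ?_
  rw [lintegral_prod _ hd'.aemeasurable, lintegral_dirac' _ hd'.lintegral_prod_right']

/-- Disintegrate `γ` over its first marginal and send the `i`-th point to the conditional law at `x
i`. Repeated points share one conditional law, so they cause no trouble. -/
theorem exists_plan_of_mem_couplings [StandardBorelSpace S] [Nonempty S] (hN : N ≠ 0)
    {d : S → S → ℝ} (hd : Measurable (Function.uncurry d)) {υ : Measure S} (x : Fin N → S)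
    {γ : Measure (S × S)} (hγ : γ ∈ couplings (empirical x) υ) :
    ∃ κ ∈ plans N υ, planCost d κ x = ∫⁻ z, ENNReal.ofReal (d z.1 z.2) ∂γ := by
  have hd' : Measurable fun z : S × S => ENNReal.ofReal (d z.1 z.2) := hd.ennreal_ofReal
  have := isProbabilityMeasure_empirical hN x
  have hγp : IsProbabilityMeasure γ := by
    have h : IsProbabilityMeasure (γ.map Prod.fst) := by rw [hγ.1]; infer_instance
    exact (Measure.isProbabilityMeasure_map_iff measurable_fst.aemeasurable).1 h
  have key (f : S × S → ℝ≥0∞) (hf : Measurable f) :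
      ∫⁻ z, f z ∂γ = (N : ℝ≥0∞)⁻¹ * ∑ i, ∫⁻ z, f (x i, z) ∂γ.condKernel (x i) := by
    conv_lhs => rw [← γ.disintegrate γ.condKernel]
    rw [Measure.lintegral_compProd hf, Measure.fst, hγ.1, empirical, lintegral_average]
    congr 1
    refine Finset.sum_congr rfl fun i _ => ?_
    exact lintegral_dirac' _ hf.lintegral_kernel_prod_right'
  refine ⟨fun i => γ.condKernel (x i), ⟨fun i => inferInstance, ?_⟩, (key _ hd').symm⟩
  refine Measure.ext_of_lintegral _ fun f hf => ?_
  rw [lintegral_average, ← hγ.2, lintegral_map hf measurable_snd]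
  exact (key _ (hf.comp measurable_snd)).symm

theorem wasserstein_empirical [StandardBorelSpace S] [Nonempty S] (hN : N ≠ 0)
    {d : S → S → ℝ} (hd : Measurable (Function.uncurry d)) (υ : Measure S) (x : Fin N → S) :
    wasserstein d (empirical x) υ = ⨅ κ ∈ plans N υ, planCost d κ x := by
  refine le_antisymm (le_iInf₂ fun κ hκ => wasserstein_empirical_le_planCost hd hκ x)
    (le_iInf₂ fun γ hγ => ?_)
  obtain ⟨κ, hκ, h⟩ := exists_plan_of_mem_couplings hN hd x hγ
  exact (iInf₂_le κ hκ).trans h.le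

theorem exists_plan_le [StandardBorelSpace S] [Nonempty S] (hN : N ≠ 0)
    {d : S → S → ℝ} (hd : Measurable (Function.uncurry d)) (υ : Measure S)
    [IsProbabilityMeasure υ] (x : Fin N → S) {ε : ℝ≥0∞} (hε : ε ≠ 0) :
    ∃ κ ∈ plans N υ, planCost d κ x ≤ wasserstein d (empirical x) υ + ε := by
  by_cases h : wasserstein d (empirical x) υ = ∞
  · exact ⟨_, const_mem_plans hN υ, by simp [h]⟩
  · have hlt := ENNReal.lt_add_right h hε
    rw [wasserstein_empirical hN hd] at hlt
    simp only [iInf_lt_iff] at hlt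
    obtain ⟨κ, hκ, hlt⟩ := hlt
    exact ⟨κ, hκ, by rw [wasserstein_empirical hN hd]; exact hlt.le⟩

/-- The average distance between corresponding points of two samples. -/
def sampleDist (d : S → S → ℝ) (x y : Fin N → S) : ℝ≥0∞ :=
  (N : ℝ≥0∞)⁻¹ * ∑ i, ENNReal.ofReal (d (x i) (y i))

/-- Plans do not mention the starting points, so the same `κ` serves both `x` and `y`. -/
theorem planCost_le_add {d : S → S → ℝ} (htri : ∀ x y z, d x z ≤ d x y + d y z)
    {υ : Measure S} {κ : Fin N → Measure S} (hκ : κ ∈ plans N υ) (x y : Fin N → S) :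
    planCost d κ x ≤ sampleDist d x y + planCost d κ y := by
  have := hκ.1
  rw [planCost, planCost, sampleDist, ← mul_add, ← Finset.sum_add_distrib]
  gcongr with i
  calc ∫⁻ z, ENNReal.ofReal (d (x i) z) ∂κ i
      ≤ ∫⁻ z, (ENNReal.ofReal (d (x i) (y i)) + ENNReal.ofReal (d (y i) z)) ∂κ i :=
        lintegral_mono fun z => (ENNReal.ofReal_le_ofReal (htri _ (y i) _)).trans
          ENNReal.ofReal_add_le
    _ = _ := by rw [lintegral_add_left measurable_const]; simp

theorem wasserstein_empirical_le_add [StandardBorelSpace S] [Nonempty S] (hN : N ≠ 0)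
    {d : S → S → ℝ} (hd : Measurable (Function.uncurry d))
    (htri : ∀ x y z, d x z ≤ d x y + d y z) (υ : Measure S) (x y : Fin N → S) :
    wasserstein d (empirical x) υ ≤ sampleDist d x y + wasserstein d (empirical y) υ := by
  rw [wasserstein_empirical hN hd, wasserstein_empirical hN hd, ENNReal.add_iInf₂]
  · exact iInf₂_mono fun κ hκ => planCost_le_add htri hκ x y

omit [MeasurableSpace S] in
theorem sampleDist_comm {d : S → S → ℝ} (hsymm : ∀ x y, d x y = d y x) (x y : Fin N → S) :
    sampleDist d x y = sampleDist d y x := by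
  simp only [sampleDist, hsymm (x _)]

/-! ### Measurability and measurable choice of plans -/

section Topology

variable [TopologicalSpace S] {d : S → S → ℝ}

omit [MeasurableSpace S] in
theorem eventually_sampleDist_lt (hd : Continuous (Function.uncurry d)) (hself : ∀ x, d x x = 0)
    (x : Fin N → S) {ε : ℝ≥0∞} (hε : ε ≠ 0) :
    ∀ᶠ y in nhds x, sampleDist d x y < ε := by
  by_cases hN : N = 0
  · subst hN
    simp [sampleDist, pos_iff_ne_zero.2 hε]
  have hc : Continuous fun y : Fin N → S => sampleDist d x y := by
    refine ENNReal.continuous_const_mul (by simp [hN]) |>.comp ?_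
    refine continuous_finsetSum _ fun i _ => ENNReal.continuous_ofReal.comp ?_
    exact hd.comp (continuous_const.prodMk (continuous_apply i))
  refine hc.continuousAt.eventually_lt continuousAt_const ?_
  simpa [sampleDist, hself] using pos_iff_ne_zero.2 hε

variable [SecondCountableTopology S] [BorelSpace S] [StandardBorelSpace S] [Nonempty S]

theorem measurable_wasserstein_empirical (hN : N ≠ 0) (hd : Continuous (Function.uncurry d))
    (hself : ∀ x, d x x = 0) (hsymm : ∀ x y, d x y = d y x)
    (htri : ∀ x y z, d x z ≤ d x y + d y z) (υ : Measure S) :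
    Measurable fun x : Fin N → S => wasserstein d (empirical x) υ := by
  refine UpperSemicontinuous.measurable fun x c hc => ?_
  obtain ⟨ε, hε, hεc⟩ : ∃ ε : ℝ≥0∞, ε ≠ 0 ∧ ε + wasserstein d (empirical x) υ < c := by
    obtain ⟨r, hr, hr'⟩ := exists_between hc
    refine ⟨r - wasserstein d (empirical x) υ, (tsub_pos_of_lt hr).ne', ?_⟩
    rwa [tsub_add_cancel_of_le hr.le]
  filter_upwards [eventually_sampleDist_lt hd hself x hε] with y hy
  refine (wasserstein_empirical_le_add hN hd.measurable htri υ y x).trans_lt (hεc.trans_le' ?_)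
  rw [sampleDist_comm hsymm]
  gcongr

/-- Near-optimal plans can be chosen measurably, with countably many values. -/
theorem exists_measurable_plan_index (hN : N ≠ 0) (hd : Continuous (Function.uncurry d))
    (hself : ∀ x, d x x = 0) (hsymm : ∀ x y, d x y = d y x)
    (htri : ∀ x y z, d x z ≤ d x y + d y z) (υ : Measure S) [IsProbabilityMeasure υ]
    {ε : ℝ≥0∞} (hε : ε ≠ 0) :
    ∃ (K : ℕ → Fin N → Measure S) (k : (Fin N → S) → ℕ), (∀ j, K j ∈ plans N υ) ∧ Measurable k ∧
      ∀ x, planCost d (K (k x)) x ≤ wasserstein d (empirical x) υ + ε := by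
  classical
  -- One third pays for near-optimality at a centre, the other two for passing between `x` and the
  -- centre, once in the plan cost and once in `wasserstein`.
  have hε3 : ε / 3 ≠ 0 := by simpa using hε
  choose κ hκ hκle using fun z : Fin N → S => exists_plan_le hN hd.measurable υ z hε3
  let U (z : Fin N → S) : Set (Fin N → S) := interior {x | sampleDist d z x < ε / 3}
  have hU (z) : U z ∈ nhds z :=
    interior_mem_nhds.2 (eventually_sampleDist_lt hd hself z hε3)
  obtain ⟨s, hs, hsU⟩ := TopologicalSpace.countable_cover_nhds hU
  have hsne : s.Nonempty := by
    rw [Set.nonempty_iff_ne_empty]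
    rintro rfl
    simp only [Set.mem_empty_iff_false, Set.iUnion_of_empty, Set.iUnion_empty] at hsU
    exact (Set.univ_nonempty (α := Fin N → S)).ne_empty hsU.symm
  obtain ⟨z, rfl⟩ := hs.exists_eq_range hsne
  have hex (x : Fin N → S) : ∃ j, x ∈ U (z j) := by
    have : x ∈ ⋃ y ∈ Set.range z, U y := hsU ▸ Set.mem_univ x
    simpa using this
  refine ⟨fun j => κ (z j), fun x => Nat.find (hex x), fun j => hκ _,
    measurable_find hex fun j => isOpen_interior.measurableSet, fun x => ?_⟩
  set y := z (Nat.find (hex x))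
  have hxy : sampleDist d y x ≤ ε / 3 := (interior_subset (Nat.find_spec (hex x))).le
  calc planCost d (κ y) x ≤ sampleDist d x y + planCost d (κ y) y :=
        planCost_le_add htri (hκ y) x y
    _ ≤ ε / 3 + ((ε / 3 + wasserstein d (empirical x) υ) + ε / 3) := by
        gcongr
        · rwa [sampleDist_comm hsymm]
        · refine (hκle y).trans ?_
          gcongr
          refine (wasserstein_empirical_le_add hN hd.measurable htri υ y x).trans ?_
          gcongr
    _ = wasserstein d (empirical x) υ + (ε / 3 + ε / 3 + ε / 3) := by ring
    _ = _ := by rw [ENNReal.add_thirds]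

end Topology

theorem lintegral_comp_sample {Ω : Type*} [MeasurableSpace Ω] {P : Measure Ω}
    [IsProbabilityMeasure P] {m : Measure S} [IsProbabilityMeasure m]
    {X : Fin N → Ω → S} (hX : IsSample P m X)
    {f : (Fin N → S) → ℝ≥0∞} (hf : Measurable f) :
    ∫⁻ ω, f (fun i => X i ω) ∂P = ∫⁻ x, f x ∂Measure.pi fun _ => m := by
  have hXm (i) : AEMeasurable (X i) P := (hX.2 i).aemeasurable
  have h := (iIndepFun_iff_map_fun_eq_pi_map hXm).1 hX.1
  simp only [(hX.2 _).map_eq] at h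
  rw [← h, lintegral_map' hf.aemeasurable (aemeasurable_pi_lambda _ hXm)]

/-! ### Averaging over symmetries -/

section Symmetry

variable {G : Type*} [MeasurableSpace G] {μ : Measure G} [IsProbabilityMeasure μ]
  [TopologicalSpace S] [SecondCountableTopology S] [BorelSpace S] [StandardBorelSpace S]
  [Nonempty S] {d : S → S → ℝ} {a b : G → S → S} {m : Measure S}

/-- Suppose that `b g` is inverse to `a g` as far as the distances `d` are concerned. If the law of
`g ↦ a g y` is `m` for every `y`, then averaging the plans from the points `b g x` to `υ` gives a
plan from `x` to `m`. -/
theorem wasserstein_empirical_le_lintegral (hN : N ≠ 0) (hd : Continuous (Function.uncurry d))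
    (hself : ∀ x, d x x = 0) (hsymm : ∀ x y, d x y = d y x)
    (htri : ∀ x y z, d x z ≤ d x y + d y z)
    (ha : Measurable (Function.uncurry a)) (hb : Measurable (Function.uncurry b))
    (hab : ∀ g x z, d x (a g z) = d (b g x) z) (hlaw : ∀ y, μ.map (fun g => a g y) = m)
    (υ : Measure S) [IsProbabilityMeasure υ] (x : Fin N → S) :
    wasserstein d (empirical x) m
      ≤ ∫⁻ g, wasserstein d (empirical fun i => b g (x i)) υ ∂μ := by
  refine ENNReal.le_of_forall_pos_le_add fun ε hε _ => ?_
  obtain ⟨K, k, hK, hk, hKk⟩ := exists_measurable_plan_index (N := N) hN hd hself hsymm htri υ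
    (ENNReal.coe_ne_zero.2 hε.ne')
  have hbx : Measurable fun g => fun i => b g (x i) :=
    measurable_pi_lambda _ fun i => hb.comp (measurable_id.prodMk measurable_const)
  -- Indexing the plans by `ℕ` makes kernel measurability automatic; only the index has to be
  -- measurable in `g`.
  let κ (i : Fin N) : Kernel ℕ S := ⟨fun j => K j i, measurable_from_nat⟩
  have hκ (i) : IsMarkovKernel (κ i) := ⟨fun j => (hK j).1 i⟩
  let η (i : Fin N) : Kernel G S := (κ i).comap (fun g => k fun i => b g (x i)) (hk.comp hbx)
  let π (i : Fin N) : Measure S := (μ ⊗ₘ η i).map (Function.uncurry a)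
  have hπ (i : Fin N) {f : S → ℝ≥0∞} (hf : Measurable f) :
      ∫⁻ z, f z ∂π i = ∫⁻ g, ∫⁻ z, f (a g z) ∂K (k fun i => b g (x i)) i ∂μ := by
    rw [lintegral_map hf ha]
    exact Measure.lintegral_compProd (hf.comp ha)
  have hmeas (i : Fin N) {f : S → ℝ≥0∞} (hf : Measurable f) :
      Measurable fun g => ∫⁻ z, f (a g z) ∂K (k fun i => b g (x i)) i :=
    (hf.comp ha).lintegral_kernel_prod_right' (κ := η i)
  have havg {f : Fin N → S → ℝ≥0∞} (hf : ∀ i, Measurable (f i)) :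
      (N : ℝ≥0∞)⁻¹ * ∑ i, ∫⁻ z, f i z ∂π i =
        ∫⁻ g, (N : ℝ≥0∞)⁻¹ * ∑ i, ∫⁻ z, f i (a g z) ∂K (k fun i => b g (x i)) i ∂μ := by
    rw [lintegral_const_mul _ (Finset.measurable_fun_sum _ fun i _ => hmeas i (hf i)),
      lintegral_finsetSum _ fun i _ => hmeas i (hf i)]
    simp only [hπ _ (hf _)]
  have hplan : π ∈ plans N m := by
    refine ⟨fun i => Measure.isProbabilityMeasure_map ha.aemeasurable, ?_⟩
    refine Measure.ext_of_lintegral _ fun f hf => ?_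
    rw [lintegral_average, havg fun _ => hf]
    simp_rw [← lintegral_average, (hK _).2]
    -- For each `g` the plan averages to `υ`, which is independent of `g`; after the swap, `hlaw`
    -- applies for each fixed `z`.
    rw [lintegral_lintegral_swap (f := fun g z => f (a g z)) (hf.comp ha).aemeasurable]
    have (z : S) : ∫⁻ g, f (a g z) ∂μ = ∫⁻ z, f z ∂m := by
      have haz : Measurable fun g => a g z := ha.comp (measurable_id.prodMk measurable_const)
      rw [← hlaw z, lintegral_map hf haz]
    simp [this]
  calc wasserstein d (empirical x) m ≤ planCost d π x :=
        wasserstein_empirical_le_planCost hd.measurable hplan x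
    _ = ∫⁻ g, planCost d (K (k fun i => b g (x i))) (fun i => b g (x i)) ∂μ := by
        rw [planCost, havg (f := fun i z => ENNReal.ofReal (d (x i) z)) fun i =>
          (hd.measurable.comp (measurable_const.prodMk measurable_id)).ennreal_ofReal]
        simp only [planCost, hab]
    _ ≤ ∫⁻ g, (wasserstein d (empirical fun i => b g (x i)) υ + ε) ∂μ :=
        lintegral_mono fun g => hKk _
    _ = _ := by rw [lintegral_add_right _ measurable_const]; simp

variable {Ω : Type*} [MeasurableSpace Ω] {P : Measure Ω} [IsProbabilityMeasure P]

theorem mem_minimizers_of_symmetric [IsProbabilityMeasure m] (hN : N ≠ 0)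
    (hd : Continuous (Function.uncurry d))
    (hself : ∀ x, d x x = 0) (hsymm : ∀ x y, d x y = d y x)
    (htri : ∀ x y z, d x z ≤ d x y + d y z)
    (ha : Measurable (Function.uncurry a)) (hb : Measurable (Function.uncurry b))
    (hab : ∀ g x z, d x (a g z) = d (b g x) z) (hlaw : ∀ y, μ.map (fun g => a g y) = m)
    (hbm : ∀ g, m.map (b g) = m) {X : Fin N → Ω → S} (hX : IsSample P m X) :
    m ∈ minimizers P d X := by
  refine ⟨inferInstance, fun υ _ => ?_⟩
  have hW (υ : Measure S) : Measurable fun x : Fin N → S => wasserstein d (empirical x) υ :=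
    measurable_wasserstein_empirical hN hd hself hsymm htri υ
  have hbN (g : G) : Measurable fun x : Fin N → S => fun i => b g (x i) :=
    measurable_pi_lambda _ fun i => hb.comp (measurable_const.prodMk (measurable_pi_apply i))
  have hbN' : Measurable fun q : (Fin N → S) × G => fun i => b q.2 (q.1 i) :=
    measurable_pi_lambda _ fun i =>
      hb.comp (measurable_snd.prodMk ((measurable_pi_apply i).comp measurable_fst))
  rw [expectedWasserstein, expectedWasserstein, lintegral_comp_sample hX (hW m),
    lintegral_comp_sample hX (hW υ)]
  calc ∫⁻ x, wasserstein d (empirical x) m ∂Measure.pi (fun _ : Fin N => m)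
      ≤ ∫⁻ x, ∫⁻ g, wasserstein d (empirical fun i => b g (x i)) υ ∂μ
          ∂Measure.pi (fun _ : Fin N => m) :=
        lintegral_mono fun x => wasserstein_empirical_le_lintegral hN hd hself hsymm htri
          ha hb hab hlaw υ x
    _ = ∫⁻ g, ∫⁻ x, wasserstein d (empirical fun i => b g (x i)) υ
          ∂Measure.pi (fun _ : Fin N => m) ∂μ :=
        lintegral_lintegral_swap ((hW υ).comp hbN').aemeasurable
    _ = ∫⁻ _, ∫⁻ x, wasserstein d (empirical x) υ ∂Measure.pi (fun _ : Fin N => m) ∂μ := by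
        refine lintegral_congr fun g => ?_
        have hbg : MeasurePreserving (b g) m m :=
          ⟨hb.comp (measurable_const.prodMk measurable_id), hbm g⟩
        exact (measurePreserving_pi _ _ fun _ : Fin N => hbg).lintegral_comp (hW υ)
    _ = _ := by simp

end Symmetry

end BestGuess

namespace BestGuess

/-! ### The Boolean cube -/

theorem discreteMeasurableSpace_intUnits : DiscreteMeasurableSpace ℤˣ :=
  ⟨fun s => ⟨Units.val '' s, .of_discrete, Set.preimage_image_eq s Units.val_injective⟩⟩

theorem cubeUniform_map {n : ℕ} (e : Cube n ≃ Cube n) :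
    (cubeUniform n).map e = cubeUniform n := by
  have := discreteMeasurableSpace_intUnits
  have he : Measurable e := .of_discrete
  ext s hs
  rw [Measure.map_apply he hs, cubeUniform, uniformOn_univ, uniformOn_univ]
  congr 1
  rw [← Equiv.image_symm_eq_preimage, Measure.count_injective_image e.symm.injective]

theorem cubeUniform_mem_minimizers {N n : ℕ} (hN : N ≠ 0) {Ω : Type*} [MeasurableSpace Ω]
    {P : Measure Ω} [IsProbabilityMeasure P] {X : Fin N → Ω → Cube n}
    (hX : IsSample P (cubeUniform n) X) :
    cubeUniform n ∈ minimizers P (cubeDist n) X := by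
  have := discreteMeasurableSpace_intUnits
  have : BorelSpace ℤˣ := inferInstance
  have : StandardBorelSpace ℤˣ := inferInstance
  have : IsProbabilityMeasure (cubeUniform n) :=
    isProbabilityMeasure_uniformOn Set.finite_univ Set.univ_nonempty
  refine mem_minimizers_of_symmetric (μ := cubeUniform n) (a := fun g x => g * x)
    (b := fun g x => g⁻¹ * x) hN continuous_of_discreteTopology (fun x => by simp [cubeDist])
    (fun x y => by simp [cubeDist, hammingDist_comm]) (fun x y z => ?_) .of_discrete .of_discrete
    (fun g x z => ?_) (fun y => cubeUniform_map (Equiv.mulRight y))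
    (fun g => cubeUniform_map (Equiv.mulLeft g⁻¹)) hX
  · rw [cubeDist, cubeDist, cubeDist]
    exact_mod_cast hammingDist_triangle x y z
  · simp only [cubeDist, hammingDist, Pi.mul_apply, Pi.inv_apply, ne_eq, inv_mul_eq_iff_eq_mul]

/-! ### The torus -/

theorem torusUniform_mem_minimizers {N n : ℕ} (hN : N ≠ 0) {p : ℝ≥0∞} (hp : 1 ≤ p) {Ω : Type*}
    [MeasurableSpace Ω] {P : Measure Ω} [IsProbabilityMeasure P] {X : Fin N → Ω → Torus n}
    (hX : IsSample P (torusUniform n) X) :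
    torusUniform n ∈ minimizers P (torusDist n p) X := by
  have : Fact (1 ≤ p) := ⟨hp⟩
  have : IsProbabilityMeasure (volume : Measure UnitAddCircle) := ⟨UnitAddCircle.measure_univ⟩
  have : IsProbabilityMeasure (torusUniform n) :=
    inferInstanceAs
      (IsProbabilityMeasure (Measure.pi fun _ : Fin n => (volume : Measure UnitAddCircle)))
  have hleft (g : Torus n) : (torusUniform n).map (fun x => g + x) = torusUniform n :=
    map_add_left_eq_self (volume : Measure (Torus n)) g
  refine mem_minimizers_of_symmetric (μ := torusUniform n) (a := fun g x => g + x)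
    (b := fun g x => -g + x) hN ?_ (fun x => by simp [torusDist])
    (fun x y => ?_) (fun x y z => ?_) measurable_add ?_
    (fun g x z => ?_) (fun y => ?_) (fun g => hleft (-g)) hX
  · exact ((PiLp.continuous_toLp p _).comp (continuous_fst.sub continuous_snd)).norm
  · rw [torusDist, torusDist, ← neg_sub, WithLp.toLp_neg, norm_neg]
  · rw [torusDist, torusDist, torusDist, ← sub_add_sub_cancel x y z, WithLp.toLp_add]
    exact norm_add_le _ _
  · exact measurable_fst.neg.add measurable_snd
  · rw [torusDist, torusDist]
    congr 2
    abel
  · simpa only [add_comm] using hleft y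

/-! ### The sphere -/

open scoped Pointwise in
/-- The surface measure of the unit sphere is invariant under linear isometries. -/
theorem toSphere_map_linearIsometryEquiv {E : Type*} [NormedAddCommGroup E]
    [InnerProductSpace ℝ E] [FiniteDimensional ℝ E] [MeasurableSpace E] [BorelSpace E]
    (e : E ≃ₗᵢ[ℝ] E) {f : Metric.sphere (0 : E) 1 → Metric.sphere (0 : E) 1}
    (hfe : ∀ x, (f x : E) = e x) :
    (volume : Measure E).toSphere.map f = (volume : Measure E).toSphere := by
  have hf : Measurable f := by
    refine Measurable.subtype_mk (h := fun x => (f x).2) ?_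
    simp only [hfe]
    exact e.continuous.measurable.comp measurable_subtype_coe
  ext s hs
  -- Surface measure is, up to a dimensional factor, the volume of the cone over a set, and `e`
  -- preserves volume and carries cones to cones.
  rw [Measure.map_apply hf hs, Measure.toSphere_apply' _ (hf hs), Measure.toSphere_apply' _ hs,
    ← e.measurePreserving.measure_preimage_emb e.toHomeomorph.measurableEmbedding
      (Set.Ioo (0 : ℝ) 1 • (Subtype.val '' s))]
  congr 2
  ext x
  simp only [Set.mem_smul, Set.mem_image, Set.mem_preimage, Subtype.exists]
  constructor
  · rintro ⟨r, hr, _, ⟨y, hy, hys, rfl⟩, rfl⟩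
    refine ⟨r, hr, _, ⟨_, (f ⟨y, hy⟩).2, hys, rfl⟩, ?_⟩
    simp [hfe]
  · rintro ⟨r, hr, _, ⟨y, hy, hys, rfl⟩, h⟩
    have hy' : ‖y‖ = 1 := by simpa using hy
    have hmem : e.symm y ∈ Metric.sphere (0 : E) 1 := by simpa using hy'
    refine ⟨r, hr, _, ⟨e.symm y, hmem, ?_, rfl⟩, ?_⟩
    · convert hys
      simp [hfe]
    · rw [← map_smul e.symm, h, e.symm_apply_apply]

section Rotations

variable (E : Type*) [NormedAddCommGroup E] [InnerProductSpace ℝ E] [FiniteDimensional ℝ E]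

local instance continuousStar_continuousLinearMap : ContinuousStar (E →L[ℝ] E) :=
  ⟨(ContinuousLinearMap.adjoint (𝕜 := ℝ) (E := E) (F := E)).continuous⟩

theorem compactSpace_unitary : CompactSpace (unitary (E →L[ℝ] E)) := by
  refine isCompact_iff_compactSpace.1 (Metric.isCompact_of_isClosed_isBounded isClosed_unitary ?_)
  refine (Metric.isBounded_closedBall (x := (0 : E →L[ℝ] E)) (r := 1)).subset fun u hu => ?_
  rw [mem_closedBall_zero_iff]
  exact ContinuousLinearMap.opNorm_le_bound _ zero_le_one fun x => by
    rw [one_mul, u.norm_map_of_mem_unitary hu]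

/-- A compact group carries a right-invariant probability measure. -/
theorem exists_isMulRightInvariant_probabilityMeasure (G : Type*) [Group G] [TopologicalSpace G]
    [IsTopologicalGroup G] [CompactSpace G] [MeasurableSpace G] [BorelSpace G] :
    ∃ μ : Measure G, IsProbabilityMeasure μ ∧ μ.IsMulRightInvariant := by
  let μ : Measure G := Measure.haarMeasure ⊤
  have : IsProbabilityMeasure μ := ⟨Measure.haarMeasure_self⟩
  -- Haar measure is left-invariant; inversion makes it right-invariant, as needed for `g ↦ g * h`
  -- in `map_rotate_eq`.
  exact ⟨μ.inv, Measure.isProbabilityMeasure_map measurable_inv.aemeasurable, inferInstance⟩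

variable {E} in
/-- The action of an orthogonal map on the unit sphere. -/
def rotate (g : unitary (E →L[ℝ] E)) (x : Metric.sphere (0 : E) 1) : Metric.sphere (0 : E) 1 :=
  ⟨(g : E →L[ℝ] E) x, by simp [Unitary.norm_map]⟩

variable {E} in
theorem continuous_rotate : Continuous (Function.uncurry (rotate (E := E))) := by
  refine Continuous.subtype_mk ?_ _
  exact (continuous_subtype_val.comp continuous_fst).clm_apply
    (continuous_subtype_val.comp continuous_snd)

variable {E} in
-- Since `x` and `y` have equal norm, reflection in the hyperplane orthogonal to `x - y` exchanges
-- them. Allowing reflections also covers the two-point sphere.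
theorem exists_rotate_eq (x y : Metric.sphere (0 : E) 1) :
    ∃ h : unitary (E →L[ℝ] E), rotate h x = y := by
  refine ⟨Unitary.linearIsometryEquiv.symm (Submodule.reflection (ℝ ∙ (x - y : E))ᗮ), ?_⟩
  exact Subtype.ext (Submodule.reflection_sub (by simp))

variable {E} in
theorem rotate_mul (g h : unitary (E →L[ℝ] E)) (x : Metric.sphere (0 : E) 1) :
    rotate (g * h) x = rotate g (rotate h x) := rfl

/-- A rotation-invariant probability measure on the sphere is the law of the image of any given
point under a random rotation. -/
theorem map_rotate_eq [MeasurableSpace E] [BorelSpace E]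
    [MeasurableSpace (unitary (E →L[ℝ] E))] [BorelSpace (unitary (E →L[ℝ] E))]
    {μ : Measure (unitary (E →L[ℝ] E))} [IsProbabilityMeasure μ] [μ.IsMulRightInvariant]
    {m : Measure (Metric.sphere (0 : E) 1)} [IsProbabilityMeasure m]
    (hm : ∀ g, m.map (rotate g) = m) (y : Metric.sphere (0 : E) 1) :
    μ.map (fun g => rotate g y) = m := by
  have hrot : Measurable (Function.uncurry (rotate (E := E))) := continuous_rotate.measurable
  have hy (y) : Measurable fun g : unitary (E →L[ℝ] E) => rotate g y :=
    hrot.comp (measurable_id.prodMk measurable_const)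
  have hg (g) : Measurable (rotate (E := E) g) :=
    hrot.comp (measurable_const.prodMk measurable_id)
  refine Measure.ext_of_lintegral _ fun f hf => ?_
  rw [lintegral_map hf (hy y)]
  -- Transitivity and right invariance make the law of `rotate g z` independent of `z`; averaging
  -- over `z` with law `m` then identifies it.
  have hconst (z) : ∫⁻ g, f (rotate g z) ∂μ = ∫⁻ g, f (rotate g y) ∂μ := by
    obtain ⟨h, rfl⟩ := exists_rotate_eq y z
    simp only [← rotate_mul]
    exact lintegral_mul_right_eq_self (fun g => f (rotate g y)) h
  calc ∫⁻ g, f (rotate g y) ∂μ = ∫⁻ z, ∫⁻ g, f (rotate g z) ∂μ ∂m := by simp [hconst]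
    _ = ∫⁻ g, ∫⁻ z, f (rotate g z) ∂m ∂μ :=
        lintegral_lintegral_swap (f := fun z g => f (rotate g z))
          (hf.comp (hrot.comp measurable_swap)).aemeasurable
    _ = ∫⁻ g, ∫⁻ z, f z ∂m ∂μ := by
        refine lintegral_congr fun g => ?_
        conv_rhs => rw [← hm g, lintegral_map hf (hg g)]
    _ = _ := by simp

end Rotations

/-- Gives access to the triangle inequality for angles. -/
theorem sphereDist_eq_angle {n : ℕ} (x y : UnitSphere n) :
    sphereDist n x y = InnerProductGeometry.angle (x : EuclideanSpace ℝ (Fin n)) y := by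
  simp [sphereDist, InnerProductGeometry.angle]

theorem sphereUniform_mem_minimizers {N n : ℕ} (hN : N ≠ 0) (hn : 1 ≤ n) {Ω : Type*}
    [MeasurableSpace Ω] {P : Measure Ω} [IsProbabilityMeasure P] {X : Fin N → Ω → UnitSphere n}
    (hX : IsSample P (sphereUniform n) X) :
    sphereUniform n ∈ minimizers P (sphereDist n) X := by
  let E := EuclideanSpace ℝ (Fin n)
  have : Nonempty (Fin n) := ⟨⟨0, hn⟩⟩
  have : Nontrivial E := inferInstanceAs (Nontrivial (EuclideanSpace ℝ (Fin n)))
  have : Nonempty (UnitSphere n) := (NormedSpace.sphere_nonempty.2 zero_le_one).to_subtype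
  have : IsProbabilityMeasure (sphereUniform n) := by
    refine ⟨?_⟩
    rw [sphereUniform, Measure.smul_apply, smul_eq_mul, ENNReal.inv_mul_cancel]
    · exact Measure.measure_univ_ne_zero.2 (Measure.toSphere_ne_zero _)
    · exact measure_ne_top _ _
  have hself (x : UnitSphere n) : sphereDist n x x = 0 := by simp [sphereDist]
  have := continuousStar_continuousLinearMap E
  have := compactSpace_unitary E
  let _ : MeasurableSpace (unitary (E →L[ℝ] E)) := borel _
  have : BorelSpace (unitary (E →L[ℝ] E)) := ⟨rfl⟩
  obtain ⟨μ, _, _⟩ := exists_isMulRightInvariant_probabilityMeasure (unitary (E →L[ℝ] E))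
  have hinv (g : unitary (E →L[ℝ] E)) : (sphereUniform n).map (rotate g) = sphereUniform n := by
    rw [sphereUniform, Measure.map_smul,
      toSphere_map_linearIsometryEquiv (Unitary.linearIsometryEquiv g) fun _ => rfl]
  refine mem_minimizers_of_symmetric (μ := μ) (a := rotate) (b := fun g => rotate g⁻¹) hN ?_ hself
    (fun x y => ?_) (fun x y z => ?_) continuous_rotate.measurable ?_ (fun g x z => ?_)
    (map_rotate_eq E hinv) (fun g => hinv g⁻¹) hX
  · exact Real.continuous_arccos.comp
      ((continuous_subtype_val.comp continuous_fst).inner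
        (continuous_subtype_val.comp continuous_snd))
  · simp only [sphereDist_eq_angle, InnerProductGeometry.angle_comm]
  · simp only [sphereDist_eq_angle]
    exact InnerProductGeometry.angle_le_angle_add_angle _ _ _
  · exact (continuous_rotate.comp (continuous_fst.inv.prodMk continuous_snd)).measurable
  · have h : x = rotate g (rotate g⁻¹ x) := by
      rw [← rotate_mul, mul_inv_cancel]
      rfl
    conv_lhs => rw [h]
    exact congrArg Real.arccos (Unitary.inner_map_map g _ _)

end BestGuess

end

theorem corollary6p2 (N : ℕ) (hN : 1 ≤ N) (n : ℕ)
    {Ω : Type*} [MeasurableSpace Ω] (P : Measure Ω) [IsProbabilityMeasure P] :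
    (∀ X : Fin N → Ω → BestGuess.Cube n,
      BestGuess.IsSample P (BestGuess.cubeUniform n) X →
        BestGuess.cubeUniform n ∈ BestGuess.minimizers P (BestGuess.cubeDist n) X) ∧
    (∀ p : ℝ≥0∞, 1 ≤ p → ∀ X : Fin N → Ω → BestGuess.Torus n,
      BestGuess.IsSample P (BestGuess.torusUniform n) X →
        BestGuess.torusUniform n ∈ BestGuess.minimizers P (BestGuess.torusDist n p) X) ∧
    (1 ≤ n → ∀ X : Fin N → Ω → BestGuess.UnitSphere n,
      BestGuess.IsSample P (BestGuess.sphereUniform n) X →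
        BestGuess.sphereUniform n ∈ BestGuess.minimizers P (BestGuess.sphereDist n) X) := by
  have hN' : N ≠ 0 := by omega
  exact ⟨fun _ hX => BestGuess.cubeUniform_mem_minimizers hN' hX,
    fun _ hp _ hX => BestGuess.torusUniform_mem_minimizers hN' hp hX,
    fun hn _ hX => BestGuess.sphereUniform_mem_minimizers hN' hn hX⟩
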